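/- **Proposition (exponential martingale).** Let $T\in[1,\infty]$, write $[0,T]$ for $\{t\in[0,\infty):t\le T\}$, and let $(\Omega,\mathcal F,(\mathcal F_t)_{t\in[0,T]},P)$ be a filtered probability space. Let $L=(L_t)_{t\in[0,T]}$ be a real-valued Lévy process, that is, an adapted process with almost surely càdlàg paths and $L_0=0$ a.s. such that $L_t-L_s$ is independent of $\mathcal F_s$ for all $s<t$ in $[0,T]$, the law of $L_t-L_s$ ($s\le t$) depends only on $t-s$, and $L_s\to L_t$ in probability as $s\to t$, for every $t\in[0,T]$. Let $(b,c,\nu)$ be the Lévy triplet of $L$: $b\in\mathbb R$, $c\ge 0$, $\nu$ is a measure on $\mathbb R$ with $\nu(\{0\})=0$ and $\int_{\mathbb R}(1\wedge|x|^2)\,\nu(dx)<\infty$, and for all $v\in\mathbb R$ $$E\big[e^{ivL_1}\big]=\exp\Big(ivb-\frac{v^2c}{2}+\int_{\mathbb R}\big(e^{ivx}-1-ivx\,1_{\{|x|<1\}}\big)\,\nu(dx)\Big).$$ Let $u\in\mathbb R$ be such that $\int_{|x|\ge1}e^{ux}\,\nu(dx)<\infty$. Then $E[e^{uL_1}]<\infty$,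 so that $\kappa(u)=\log E[e^{uL_1}]$ is a well-defined real number, and the process $M=(M_t)_{t\in[0,T]}$ given by $$M_t=\frac{e^{uL_t}}{e^{t\kappa(u)}}$$ is a martingale with respect to $(\mathcal F_t)_{t\in[0,T]}$ and $P$. -/

import Mathlib

open MeasureTheory ProbabilityTheory Filter Topology
open scoped NNReal ENNReal

/-- The time set `{t ∈ [0, ∞) : t ≤ T}` for a time horizon `T ∈ [0, ∞]`: it is `[0, T]` if `T` is
finite and `[0, ∞)` if `T = ∞`. -/
abbrev TimeSet (T : ℝ≥0∞) : Type := {t : ℝ≥0 // (t : ℝ≥0∞) ≤ T}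

/-- The time `0`. -/
def TimeSet.zero (T : ℝ≥0∞) : TimeSet T := ⟨0, by simp⟩

/-- The time `1`, which exists if the horizon is at least `1`. -/
def TimeSet.one {T : ℝ≥0∞} (hT : 1 ≤ T) : TimeSet T := ⟨1, by simpa using hT⟩

/-- A path is càdlàg: right continuous with left limits at every time. -/
def IsCadlagPath {T : ℝ≥0∞} (x : TimeSet T → ℝ) : Prop :=
  ∀ t, ContinuousWithinAt x (Set.Ici t) t ∧ ∃ l : ℝ, Tendsto x (𝓝[<] t) (𝓝 l)

/-- `L` is a (real-valued) Lévy process with respect to the filtration `𝓕`, under `P`. -/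
structure IsLevyProcess {Ω : Type*} {mΩ : MeasurableSpace Ω} {T : ℝ≥0∞} (P : Measure Ω)
    (𝓕 : Filtration (TimeSet T) mΩ) (L : TimeSet T → Ω → ℝ) : Prop where
  adapted : Adapted 𝓕 L
  cadlag : ∀ᵐ ω ∂P, IsCadlagPath fun t => L t ω
  zero : ∀ᵐ ω ∂P, L (TimeSet.zero T) ω = 0
  indep_increments : ∀ s t : TimeSet T, s < t →
    Indep (MeasurableSpace.comap (fun ω => L t ω - L s ω) inferInstance) (𝓕 s) P
  stationary_increments : ∀ s t s' t' : TimeSet T, s ≤ t → s' ≤ t' →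
    (t : ℝ) - (s : ℝ) = (t' : ℝ) - (s' : ℝ) →
    IdentDistrib (fun ω => L t ω - L s ω) (fun ω => L t' ω - L s' ω) P P
  stochastically_continuous : ∀ t : TimeSet T, TendstoInMeasure P L (𝓝 t) (L t)

/-- A Lévy measure: a measure `ν` on `ℝ` with `ν({0}) = 0` and `∫ (1 ∧ |x|²) ν(dx) < ∞`. -/
structure IsLevyMeasure (ν : Measure ℝ) : Prop where
  zero : ν {0} = 0
  lintegral_lt_top : ∫⁻ x, ENNReal.ofReal (min 1 (|x| ^ 2)) ∂ν < ∞

/-- The characteristic exponent of the triplet `(b, c, ν)`,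
`ψ(v) = i v b - v² c / 2 + ∫ (exp (i v x) - 1 - i v x 1_{|x| < 1}) ν(dx)`.
The integral converges absolutely when `ν` is a Lévy measure. -/
noncomputable def charExponent (b : ℝ) (c : ℝ≥0) (ν : Measure ℝ) (v : ℝ) : ℂ :=
  Complex.I * v * b - (v : ℂ) ^ 2 * ((c : ℝ) : ℂ) / 2 +
    ∫ x : ℝ, (Complex.exp (Complex.I * v * x) - 1 -
      Set.indicator {y : ℝ | |y| < 1} (fun y => Complex.I * v * y) x) ∂ν

/-- The Lévy process `L` has the Lévy triplet `(b, c, ν)`: the measure `ν` is a Lévy measure and the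
law of `L₁` has the Lévy–Khintchine representation with this triplet. -/
structure HasLevyTriplet {Ω : Type*} {mΩ : MeasurableSpace Ω} {T : ℝ≥0∞} (hT : 1 ≤ T)
    (P : Measure Ω) (L : TimeSet T → Ω → ℝ) (b : ℝ) (c : ℝ≥0) (ν : Measure ℝ) : Prop where
  isLevyMeasure : IsLevyMeasure ν
  charFun_eq : ∀ v : ℝ,
    ∫ ω, Complex.exp (Complex.I * v * L (TimeSet.one hT) ω) ∂P = Complex.exp (charExponent b c ν v)

/-! ### Complex exponential moments of compound Poisson laws -/

section ExponentialMoments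

/-! Finiteness at time 1: discarding jumps smaller than `ε` leaves a Gaussian convolved with a
compound Poisson law, whose moment at complex `z` is explicit (`integral_cexp_truncatedLaw`) and
converges as `ε → 0`. At `z = iv` this gives convergence of characteristic functions, hence weak
convergence to the law of `L₁`; at `z = u` the real moments stay bounded, and Fatou's lemma for weak
convergence bounds `E[exp (u L₁)]`.

Dependence on time: independent stationary increments make `t ↦ E[exp (u L_t)]` multiplicative, so
it equals `exp (tκ)` at rational `t`. Fatou's lemma along rationals gives only `≤` elsewhere; since
the values at `s` and `1 - s` multiply to `exp κ`, neither inequality can be strict.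

Finally `M_t` is `M_s` times a factor of mean 1 independent of `𝓕 s`. -/

theorem integrable_cexp_conv {μ ν : Measure ℝ} [SFinite μ] [SFinite ν] {z : ℂ}
    (hμ : Integrable (fun x : ℝ => Complex.exp (z * x)) μ)
    (hν : Integrable (fun x : ℝ => Complex.exp (z * x)) ν) :
    Integrable (fun x : ℝ => Complex.exp (z * x)) (μ ∗ ν) := by
  rw [Measure.conv, integrable_map_measure (by fun_prop) (by fun_prop)]
  refine (hμ.mul_prod hν).congr (Eventually.of_forall fun p => ?_)
  simp [← Complex.exp_add, mul_add]

theorem integral_cexp_conv {μ ν : Measure ℝ} [SFinite μ] [SFinite ν] (z : ℂ) :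
    ∫ x : ℝ, Complex.exp (z * x) ∂(μ ∗ ν) =
      (∫ x : ℝ, Complex.exp (z * x) ∂μ) * ∫ x : ℝ, Complex.exp (z * x) ∂ν := by
  rw [Measure.conv, integral_map (by fun_prop) (by fun_prop), ← integral_prod_mul]
  refine integral_congr_ae (Eventually.of_forall fun p => ?_)
  simp [← Complex.exp_add, mul_add]

/-- The `n`-fold convolution power of a measure on `ℝ`. -/
noncomputable def convPow (ρ : Measure ℝ) : ℕ → Measure ℝ
  | 0 => Measure.dirac 0
  | n + 1 => convPow ρ n ∗ ρ

instance isFiniteMeasure_convPow (ρ : Measure ℝ) [IsFiniteMeasure ρ] (n : ℕ) :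
    IsFiniteMeasure (convPow ρ n) := by
  induction n with
  | zero => unfold convPow; infer_instance
  | succ n ih => unfold convPow; infer_instance

theorem integrable_cexp_convPow {ρ : Measure ℝ} [IsFiniteMeasure ρ] {z : ℂ}
    (hρ : Integrable (fun x : ℝ => Complex.exp (z * x)) ρ) (n : ℕ) :
    Integrable (fun x : ℝ => Complex.exp (z * x)) (convPow ρ n) := by
  induction n with
  | zero => exact integrable_dirac (by simp)
  | succ n ih => exact integrable_cexp_conv ih hρ

theorem integral_cexp_convPow (ρ : Measure ℝ) [IsFiniteMeasure ρ] (z : ℂ) (n : ℕ) :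
    ∫ x : ℝ, Complex.exp (z * x) ∂(convPow ρ n) = (∫ x : ℝ, Complex.exp (z * x) ∂ρ) ^ n := by
  induction n with
  | zero => simp [convPow]
  | succ n ih => rw [convPow, integral_cexp_conv, ih, pow_succ]

/-- The compound Poisson distribution with jump measure `ρ`, where `ρ` is finite. -/
noncomputable def compoundPoisson (ρ : Measure ℝ) : Measure ℝ :=
  Measure.sum fun n : ℕ =>
    ENNReal.ofReal (Real.exp (-ρ.real Set.univ) / n.factorial) • convPow ρ n

/-- Rewrites absolute moments as exponential moments at `z.re`, so that they too obey the product
formula for convolutions. -/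
theorem integral_norm_cexp {μ : Measure ℝ} {z : ℂ} :
    ((∫ x : ℝ, ‖Complex.exp (z * x)‖ ∂μ : ℝ) : ℂ) = ∫ x : ℝ, Complex.exp ((z.re : ℂ) * x) ∂μ := by
  rw [← integral_complex_ofReal]
  refine integral_congr_ae (Eventually.of_forall fun x => ?_)
  simp [Complex.norm_exp]

theorem integrable_cexp_compoundPoisson {ρ : Measure ℝ} [IsFiniteMeasure ρ] {z : ℂ}
    (hρ : Integrable (fun x : ℝ => Complex.exp (z * x)) ρ) :
    Integrable (fun x : ℝ => Complex.exp (z * x)) (compoundPoisson ρ) := by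
  refine integrable_sum_measure
    (fun n => (integrable_cexp_convPow hρ n).smul_measure ENNReal.ofReal_ne_top) ?_
  have key : ∀ n : ℕ, ∫ x : ℝ, ‖Complex.exp (z * x)‖ ∂(convPow ρ n) =
      (∫ x : ℝ, ‖Complex.exp (z * x)‖ ∂ρ) ^ n := by
    intro n
    have h := integral_cexp_convPow ρ (z.re : ℂ) n
    rw [← integral_norm_cexp, ← integral_norm_cexp] at h
    exact_mod_cast h
  simp_rw [integral_smul_measure, key]
  -- The absolute moments of the convolution powers form a geometric sequence, so the Poisson
  -- weights turn their sum into an exponential series.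
  refine ((Real.summable_pow_div_factorial
    (∫ x : ℝ, ‖Complex.exp (z * x)‖ ∂ρ)).mul_left (Real.exp (-ρ.real Set.univ))).congr fun n => ?_
  rw [ENNReal.toReal_ofReal (by positivity), smul_eq_mul]
  ring

theorem integral_cexp_compoundPoisson {ρ : Measure ℝ} [IsFiniteMeasure ρ] {z : ℂ}
    (hρ : Integrable (fun x : ℝ => Complex.exp (z * x)) ρ) :
    ∫ x : ℝ, Complex.exp (z * x) ∂(compoundPoisson ρ) =
      Complex.exp (∫ x : ℝ, (Complex.exp (z * x) - 1) ∂ρ) := by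
  have h := hasSum_integral_measure (integrable_cexp_compoundPoisson hρ)
  change HasSum _ (∫ x : ℝ, Complex.exp (z * x) ∂(compoundPoisson ρ)) at h
  simp_rw [integral_smul_measure, integral_cexp_convPow] at h
  have h' := (NormedSpace.expSeries_div_hasSum_exp
    (∫ x : ℝ, Complex.exp (z * x) ∂ρ)).mul_left (Complex.exp (-(ρ.real Set.univ : ℝ)))
  rw [← Complex.exp_eq_exp_ℂ, ← Complex.exp_add] at h'
  rw [integral_sub hρ (integrable_const _)]
  refine h.unique ?_
  convert! h' using 2 with n
  · rw [ENNReal.toReal_ofReal (by positivity), Complex.real_smul]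
    push_cast
    ring
  · simp
    ring

instance isProbabilityMeasure_compoundPoisson (ρ : Measure ℝ) [IsFiniteMeasure ρ] :
    IsProbabilityMeasure (compoundPoisson ρ) := by
  -- At `z = 0` the moment formula computes the total mass.
  have h0 : Integrable (fun x : ℝ => Complex.exp ((0 : ℂ) * x)) ρ := by simp
  have h1 : IsFiniteMeasure (compoundPoisson ρ) := by
    have := integrable_cexp_compoundPoisson h0
    simpa [integrable_const_iff] using this
  have h2 := integral_cexp_compoundPoisson h0
  simp only [zero_mul, Complex.exp_zero, sub_self, integral_zero, integral_const,
    Complex.real_smul, mul_one] at h2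
  have h3 : (compoundPoisson ρ).real Set.univ = 1 := by exact_mod_cast h2
  exact ⟨by rwa [measureReal_def, ENNReal.toReal_eq_one_iff] at h3⟩

end ExponentialMoments

/-! ### Truncating the small jumps and passing to the limit -/

section LevyKhintchine

/-- The Lévy–Khintchine integrand at the complex argument `z`. -/
noncomputable def levyIntegrand (z : ℂ) (x : ℝ) : ℂ :=
  Complex.exp (z * x) - 1 - Set.indicator {y : ℝ | |y| < 1} (fun y => z * y) x

theorem measurableSet_abs_lt_one : MeasurableSet {y : ℝ | |y| < 1} :=
  measurableSet_lt (by fun_prop) (by fun_prop)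

theorem measurableSet_le_abs (ε : ℝ) : MeasurableSet {y : ℝ | ε ≤ |y|} :=
  measurableSet_le (by fun_prop) (by fun_prop)

theorem measurable_levyIntegrand (z : ℂ) : Measurable (levyIntegrand z) :=
  (by fun_prop : Measurable fun x : ℝ => Complex.exp (z * x) - 1).sub
    ((by fun_prop : Measurable fun y : ℝ => z * y).indicator measurableSet_abs_lt_one)

/-- Second-order Taylor remainder for `|x| < 1`, triangle inequality for `|x| ≥ 1`. -/
theorem norm_levyIntegrand_le (z : ℂ) (x : ℝ) :
    ‖levyIntegrand z x‖ ≤ (‖z‖ ^ 2 * Real.exp ‖z‖ + 1) * min 1 (|x| ^ 2) +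
      Set.indicator {y : ℝ | 1 ≤ |y|} (fun y => Real.exp (z.re * y)) x := by
  by_cases hx : |x| < 1
  · have h1 : ‖Complex.exp (z * x) - 1 - z * x‖ ≤ ‖z * x‖ ^ 2 * Real.exp ‖z * x‖ := by
      have := Complex.norm_exp_sub_sum_le_norm_mul_exp (z * x) 2
      simpa [Finset.sum_range_succ, sub_sub] using this
    have h2 : ‖z * x‖ = ‖z‖ * |x| := by simp
    have h3 : ‖z‖ * |x| ≤ ‖z‖ := mul_le_of_le_one_right (norm_nonneg _) hx.le
    have h4 : min 1 (|x| ^ 2) = |x| ^ 2 := min_eq_right (pow_le_one₀ (abs_nonneg _) hx.le)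
    have h5 : x ∉ {y : ℝ | 1 ≤ |y|} := by simpa using hx
    rw [levyIntegrand, Set.indicator_of_mem (by exact hx), Set.indicator_of_notMem h5, h4]
    refine h1.trans ?_
    rw [h2]
    have h6 : Real.exp (‖z‖ * |x|) ≤ Real.exp ‖z‖ := Real.exp_le_exp.2 h3
    calc (‖z‖ * |x|) ^ 2 * Real.exp (‖z‖ * |x|) ≤ (‖z‖ * |x|) ^ 2 * Real.exp ‖z‖ := by gcongr
      _ ≤ _ := by nlinarith [sq_nonneg |x|]
  · have hx' : 1 ≤ |x| := not_lt.1 hx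
    have h4 : min 1 (|x| ^ 2) = 1 := min_eq_left (one_le_pow₀ hx')
    rw [levyIntegrand, Set.indicator_of_notMem (by exact hx), Set.indicator_of_mem (by exact hx'),
      h4]
    have h1 : ‖Complex.exp (z * x)‖ = Real.exp (z.re * x) := by simp [Complex.norm_exp]
    have h2 := norm_sub_le (Complex.exp (z * x)) 1
    rw [h1, norm_one] at h2
    rw [sub_zero]
    have : 0 ≤ ‖z‖ ^ 2 * Real.exp ‖z‖ := by positivity
    linarith

variable {ν : Measure ℝ}

theorem IsLevyMeasure.integrable_min (hν : IsLevyMeasure ν) :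
    Integrable (fun x : ℝ => min 1 (|x| ^ 2)) ν := by
  refine ⟨by fun_prop, ?_⟩
  rw [hasFiniteIntegral_iff_ofReal (Eventually.of_forall fun x => by positivity)]
  exact hν.lintegral_lt_top

theorem IsLevyMeasure.measure_le_abs_lt_top (hν : IsLevyMeasure ν) {ε : ℝ} (hε : 0 < ε) :
    ν {y : ℝ | ε ≤ |y|} < ∞ := by
  have h := hν.integrable_min.measure_ge_lt_top (ε := min 1 (ε ^ 2)) (by positivity)
  refine (measure_mono fun y hy => ?_).trans_lt h
  exact min_le_min le_rfl (pow_le_pow_left₀ hε.le hy 2)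

theorem integrable_levyIntegrand (hν : IsLevyMeasure ν) {z : ℂ}
    (hz : IntegrableOn (fun x => Real.exp (z.re * x)) {x : ℝ | 1 ≤ |x|} ν) :
    Integrable (levyIntegrand z) ν :=
  ((hν.integrable_min.const_mul _).add
    ((integrable_indicator_iff (measurableSet_le_abs 1)).2 hz)).mono'
    (measurable_levyIntegrand z).aestronglyMeasurable
    (Eventually.of_forall (norm_levyIntegrand_le z))

/-- The infinitely divisible law obtained by discarding the jumps smaller than `ε`. -/
noncomputable def truncatedLaw (b : ℝ) (c : ℝ≥0) (ν : Measure ℝ) (ε : ℝ) : Measure ℝ :=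
  gaussianReal (b - ∫ x in {y : ℝ | ε ≤ |y|}, Set.indicator {y : ℝ | |y| < 1} id x ∂ν) c ∗
    compoundPoisson (ν.restrict {y : ℝ | ε ≤ |y|})

theorem IsLevyMeasure.isFiniteMeasure_restrict (hν : IsLevyMeasure ν) {ε : ℝ} (hε : 0 < ε) :
    IsFiniteMeasure (ν.restrict {y : ℝ | ε ≤ |y|}) :=
  _root_.MeasureTheory.isFiniteMeasure_restrict.2 (hν.measure_le_abs_lt_top hε).ne

theorem isProbabilityMeasure_truncatedLaw (hν : IsLevyMeasure ν) (b : ℝ) (c : ℝ≥0) {ε : ℝ}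
    (hε : 0 < ε) : IsProbabilityMeasure (truncatedLaw b c ν ε) := by
  have := hν.isFiniteMeasure_restrict hε
  unfold truncatedLaw
  infer_instance

theorem integrable_indicator_abs_lt_one (hν : IsLevyMeasure ν) {ε : ℝ} (hε : 0 < ε) :
    Integrable (Set.indicator {y : ℝ | |y| < 1} id) (ν.restrict {y : ℝ | ε ≤ |y|}) := by
  have := hν.isFiniteMeasure_restrict hε
  refine (integrable_const (1 : ℝ)).mono'
    (measurable_id.indicator measurableSet_abs_lt_one).aestronglyMeasurable
    (Eventually.of_forall fun x => ?_)
  by_cases hx : |x| < 1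
  · rw [Set.indicator_of_mem (by exact hx)]; exact hx.le
  · rw [Set.indicator_of_notMem (by exact hx)]; simp

/-- Away from 0 the measure is finite, so the constant and the bounded compensator can be added back
to `levyIntegrand`. -/
theorem integrable_cexp_restrict (hν : IsLevyMeasure ν) {ε : ℝ} (hε : 0 < ε) {z : ℂ}
    (hz : IntegrableOn (fun x => Real.exp (z.re * x)) {x : ℝ | 1 ≤ |x|} ν) :
    Integrable (fun x : ℝ => Complex.exp (z * x)) (ν.restrict {y : ℝ | ε ≤ |y|}) := by
  have := hν.isFiniteMeasure_restrict hε
  refine (((integrable_levyIntegrand hν hz).restrict.add (integrable_const 1)).add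
    ((integrable_indicator_abs_lt_one hν hε).ofReal.const_mul z)).congr
    (Eventually.of_forall fun x => ?_)
  by_cases hx : |x| < 1 <;> (simp [levyIntegrand, Set.indicator, hx]; try ring)

theorem integrable_cexp_gaussianReal (m : ℝ) (c : ℝ≥0) (z : ℂ) :
    Integrable (fun x : ℝ => Complex.exp (z * x)) (gaussianReal m c) := by
  refine (integrable_exp_mul_gaussianReal z.re).mono' (by fun_prop)
    (Eventually.of_forall fun x => ?_)
  simp [Complex.norm_exp]

theorem integrable_cexp_truncatedLaw (hν : IsLevyMeasure ν) (b : ℝ) (c : ℝ≥0) {ε : ℝ} (hε : 0 < ε)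
    {z : ℂ} (hz : IntegrableOn (fun x => Real.exp (z.re * x)) {x : ℝ | 1 ≤ |x|} ν) :
    Integrable (fun x : ℝ => Complex.exp (z * x)) (truncatedLaw b c ν ε) := by
  have := hν.isFiniteMeasure_restrict hε
  exact integrable_cexp_conv (integrable_cexp_gaussianReal _ _ _)
    (integrable_cexp_compoundPoisson (integrable_cexp_restrict hν hε hz))

/-- The shift of the Gaussian mean supplies exactly the compensator over `ε ≤ |x| < 1` missing from
the compound Poisson exponent. -/
theorem integral_cexp_truncatedLaw (hν : IsLevyMeasure ν) (b : ℝ) (c : ℝ≥0) {ε : ℝ} (hε : 0 < ε)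
    {z : ℂ} (hz : IntegrableOn (fun x => Real.exp (z.re * x)) {x : ℝ | 1 ≤ |x|} ν) :
    ∫ x : ℝ, Complex.exp (z * x) ∂(truncatedLaw b c ν ε) =
      Complex.exp (z * b + c * z ^ 2 / 2 + ∫ x in {y : ℝ | ε ≤ |y|}, levyIntegrand z x ∂ν) := by
  have := hν.isFiniteMeasure_restrict hε
  have hexp := integrable_cexp_restrict hν hε hz
  have hind : Integrable (fun x => ((Set.indicator {y : ℝ | |y| < 1} id x : ℝ) : ℂ))
      (ν.restrict {y : ℝ | ε ≤ |y|}) := (integrable_indicator_abs_lt_one hν hε).ofReal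
  have hexp1 : Integrable (fun x : ℝ => Complex.exp (z * x) - 1)
      (ν.restrict {y : ℝ | ε ≤ |y|}) := hexp.sub (integrable_const 1)
  have h1 : ∫ x in {y : ℝ | ε ≤ |y|}, levyIntegrand z x ∂ν =
      ∫ x in {y : ℝ | ε ≤ |y|}, (Complex.exp (z * x) - 1) ∂ν -
        z * ((∫ x in {y : ℝ | ε ≤ |y|}, Set.indicator {y : ℝ | |y| < 1} id x ∂ν : ℝ) : ℂ) := by
    rw [← integral_complex_ofReal, ← integral_const_mul,
      ← integral_sub hexp1 (hind.const_mul z)]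
    refine integral_congr_ae (Eventually.of_forall fun x => ?_)
    by_cases hx : |x| < 1 <;> simp [levyIntegrand, Set.indicator, hx]
  have h2 := complexMGF_id_gaussianReal (v := c)
    (μ := b - ∫ x in {y : ℝ | ε ≤ |y|}, Set.indicator {y : ℝ | |y| < 1} id x ∂ν) z
  simp only [complexMGF, id_eq] at h2
  rw [truncatedLaw, integral_cexp_conv, integral_cexp_compoundPoisson hexp, h2, ← Complex.exp_add,
    h1]
  push_cast
  ring_nf

theorem tendsto_setIntegral_levyIntegrand (hν : IsLevyMeasure ν) {z : ℂ}
    (hz : IntegrableOn (fun x => Real.exp (z.re * x)) {x : ℝ | 1 ≤ |x|} ν) :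
    Tendsto (fun n : ℕ => ∫ x in {y : ℝ | 1 / ((n : ℝ) + 1) ≤ |y|}, levyIntegrand z x ∂ν) atTop
      (𝓝 (∫ x, levyIntegrand z x ∂ν)) := by
  have h := tendsto_setIntegral_of_monotone (μ := ν) (f := levyIntegrand z)
    (s := fun n : ℕ => {y : ℝ | 1 / ((n : ℝ) + 1) ≤ |y|}) (fun n => measurableSet_le_abs _)
    (fun m n hmn y (hy : 1 / ((m : ℝ) + 1) ≤ |y|) =>
      (Nat.one_div_le_one_div hmn).trans hy)
    (integrable_levyIntegrand hν hz).integrableOn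
  rwa [setIntegral_eq_integral_of_forall_compl_eq_zero] at h
  -- The truncation sets exhaust everything except 0, where the integrand vanishes.
  intro x hx
  have hx0 : x = 0 := by
    by_contra hne
    obtain ⟨n, hn⟩ := exists_nat_one_div_lt (abs_pos.2 hne)
    exact hx (Set.mem_iUnion.2 ⟨n, hn.le⟩)
  simp [hx0, levyIntegrand]

theorem tendsto_integral_cexp_truncatedLaw (hν : IsLevyMeasure ν) (b : ℝ) (c : ℝ≥0) {z : ℂ}
    (hz : IntegrableOn (fun x => Real.exp (z.re * x)) {x : ℝ | 1 ≤ |x|} ν) :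
    Tendsto (fun n : ℕ => ∫ x : ℝ, Complex.exp (z * x) ∂(truncatedLaw b c ν (1 / ((n : ℝ) + 1))))
      atTop (𝓝 (Complex.exp (z * b + c * z ^ 2 / 2 + ∫ x, levyIntegrand z x ∂ν))) := by
  simp_rw [fun n : ℕ => integral_cexp_truncatedLaw hν b c (Nat.one_div_pos_of_nat (n := n)) hz]
  exact (Complex.continuous_exp.tendsto _).comp
    ((tendsto_setIntegral_levyIntegrand hν hz).const_add _)

theorem charExponent_eq (b : ℝ) (c : ℝ≥0) (ν : Measure ℝ) (v : ℝ) :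
    charExponent b c ν v = Complex.I * v * b + c * (Complex.I * v) ^ 2 / 2 +
      ∫ x, levyIntegrand (Complex.I * v) x ∂ν := by
  simp only [charExponent, levyIntegrand, mul_pow, Complex.I_sq]
  congr 1
  simp
  ring

/-- The exponential moment of an infinitely divisible law is finite where the one of the
large jumps is. -/
theorem integrable_exp_of_levyKhintchine (hν : IsLevyMeasure ν) (b : ℝ) (c : ℝ≥0) (μ : Measure ℝ)
    [IsProbabilityMeasure μ] (hμ : ∀ v, charFun μ v = Complex.exp (charExponent b c ν v)) {u : ℝ}
    (hu : IntegrableOn (fun x => Real.exp (u * x)) {x : ℝ | 1 ≤ |x|} ν) :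
    Integrable (fun x => Real.exp (u * x)) μ := by
  have hpos (n : ℕ) : (0 : ℝ) < 1 / ((n : ℝ) + 1) := Nat.one_div_pos_of_nat
  let μs : ℕ → ProbabilityMeasure ℝ := fun n =>
    ⟨truncatedLaw b c ν (1 / ((n : ℝ) + 1)), isProbabilityMeasure_truncatedLaw hν b c (hpos n)⟩
  have hweak : Tendsto μs atTop (𝓝 (⟨μ, inferInstance⟩ : ProbabilityMeasure ℝ)) := by
    refine ProbabilityMeasure.tendsto_of_tendsto_charFun fun v => ?_
    -- On the imaginary axis the exponential has modulus 1, so only finiteness of `ν` on large jumps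
    -- is needed.
    have hv : IntegrableOn (fun x => Real.exp ((Complex.I * v).re * x)) {x : ℝ | 1 ≤ |x|} ν := by
      simpa using hν.measure_le_abs_lt_top one_pos
    have h := tendsto_integral_cexp_truncatedLaw hν b c hv
    rw [← charExponent_eq, ← hμ] at h
    refine h.congr fun n => ?_
    rw [charFun_apply_real]
    refine integral_congr_ae (Eventually.of_forall fun x => ?_)
    simp only
    ring_nf
  -- Fatou's lemma for weak convergence: the portmanteau bound on open sets suffices for nonnegative
  -- continuous functions, bounded or not.
  have hle := lintegral_le_liminf_lintegral_of_forall_isOpen_measure_le_liminf_measure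
    (μ := μ) (μs := fun n => truncatedLaw b c ν (1 / ((n : ℝ) + 1)))
    (f := fun x => Real.exp (u * x)) (by fun_prop) (fun x => (Real.exp_pos _).le)
    (fun G hG => ProbabilityMeasure.le_liminf_measure_open_of_tendsto hweak hG)
  have hu' : IntegrableOn (fun x => Real.exp ((u : ℂ).re * x)) {x : ℝ | 1 ≤ |x|} ν := by simpa
  have hint (n : ℕ) :
      Integrable (fun x => Real.exp (u * x)) (truncatedLaw b c ν (1 / ((n : ℝ) + 1))) := by
    refine (integrable_cexp_truncatedLaw hν b c (hpos n) hu').re.congr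
      (Eventually.of_forall fun x => ?_)
    simp [← Complex.ofReal_mul, Complex.exp_ofReal_re]
  have hlim := (Complex.continuous_re.tendsto _).comp (tendsto_integral_cexp_truncatedLaw hν b c hu')
  have hlim' : Tendsto (fun n : ℕ => ∫⁻ x, ENNReal.ofReal (Real.exp (u * x))
      ∂(truncatedLaw b c ν (1 / ((n : ℝ) + 1)))) atTop (𝓝 (ENNReal.ofReal (Complex.exp
        ((u : ℂ) * b + c * (u : ℂ) ^ 2 / 2 + ∫ x, levyIntegrand u x ∂ν)).re)) := by
    refine (ENNReal.tendsto_ofReal hlim).congr fun n => ?_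
    rw [← ofReal_integral_eq_lintegral_ofReal (hint n)
      (Eventually.of_forall fun x => (Real.exp_pos _).le)]
    congr 1
    rw [Function.comp_apply, ← Complex.ofReal_re (∫ x, Real.exp (u * x) ∂_), ← integral_complex_ofReal]
    simp
  rw [hlim'.liminf_eq] at hle
  refine ⟨by fun_prop, ?_⟩
  rw [hasFiniteIntegral_iff_ofReal (Eventually.of_forall fun x => (Real.exp_pos _).le)]
  exact hle.trans_lt ENNReal.ofReal_lt_top

end LevyKhintchine

/-! ### Exponential moments in time and the martingale property -/

section LevyProcess

variable {Ω : Type*} {mΩ : MeasurableSpace Ω} {P : Measure Ω} {T : ℝ≥0∞}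
  {𝓕 : Filtration (TimeSet T) mΩ} {L : TimeSet T → Ω → ℝ}

theorem IsLevyProcess.measurable (hL : IsLevyProcess P 𝓕 L) (t : TimeSet T) : Measurable (L t) :=
  (hL.adapted t).mono (𝓕.le t) le_rfl

/-- The exponential moments of an increment over `[s, t]` are those of the value at `t - s`. -/
theorem IsLevyProcess.lintegral_exp_increment (hL : IsLevyProcess P 𝓕 L) (u : ℝ)
    {s r t : TimeSet T} (h : (t : ℝ≥0) = s + r) :
    ∫⁻ ω, ENNReal.ofReal (Real.exp (u * (L t ω - L s ω))) ∂P =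
      ∫⁻ ω, ENNReal.ofReal (Real.exp (u * L r ω)) ∂P := by
  have hst : s ≤ t := by
    change (s : ℝ≥0) ≤ t
    simp [h]
  have h0r : TimeSet.zero T ≤ r := by
    change (0 : ℝ≥0) ≤ r
    exact zero_le
  have hid := hL.stationary_increments s t (TimeSet.zero T) r hst h0r (by
    simp [h, TimeSet.zero])
  have hm : Measurable fun x : ℝ => ENNReal.ofReal (Real.exp (u * x)) := by fun_prop
  refine ((hid.comp hm).lintegral_eq).trans (lintegral_congr_ae ?_)
  filter_upwards [hL.zero] with ω hω
  simp [hω]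

theorem IsLevyProcess.lintegral_exp_add [IsProbabilityMeasure P] (hL : IsLevyProcess P 𝓕 L) (u : ℝ)
    {s r t : TimeSet T} (h : (t : ℝ≥0) = s + r) :
    ∫⁻ ω, ENNReal.ofReal (Real.exp (u * L t ω)) ∂P =
      (∫⁻ ω, ENNReal.ofReal (Real.exp (u * L s ω)) ∂P) *
        ∫⁻ ω, ENNReal.ofReal (Real.exp (u * L r ω)) ∂P := by
  -- Independence of increments is available only for `s < t`, so `r = 0` is treated apart.
  rcases (zero_le : 0 ≤ (r : ℝ≥0)).eq_or_lt with hr | hr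
  · have hts : t = s := Subtype.ext (by rw [h, ← hr, add_zero])
    have hr0 : r = TimeSet.zero T := Subtype.ext hr.symm
    have h1 : ∫⁻ ω, ENNReal.ofReal (Real.exp (u * L r ω)) ∂P = 1 := by
      rw [show (1 : ℝ≥0∞) = ∫⁻ _, 1 ∂P by simp]
      refine lintegral_congr_ae ?_
      filter_upwards [hL.zero] with ω hω
      simp [hr0, hω]
    rw [h1, mul_one, hts]
  · have hst : s < t := by
      change (s : ℝ≥0) < t
      rw [h]
      exact lt_add_of_pos_right _ hr
    have hind : IndepFun (L s) (fun ω => L t ω - L s ω) P :=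
      (indep_of_indep_of_le_right (hL.indep_increments s t hst) (hL.adapted s).comap_le).symm
    have hm : Measurable fun x : ℝ => ENNReal.ofReal (Real.exp (u * x)) := by fun_prop
    have hprod := lintegral_mul_eq_lintegral_mul_lintegral_of_indepFun
      (hm.comp (hL.measurable s)) (hm.comp ((hL.measurable t).sub (hL.measurable s)))
      (hind.comp hm hm)
    rw [← hL.lintegral_exp_increment u h]
    refine (lintegral_congr fun ω => ?_).trans hprod
    rw [Pi.mul_apply, Function.comp_apply, Function.comp_apply,
      ← ENNReal.ofReal_mul (Real.exp_pos _).le, ← Real.exp_add]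
    simp [mul_sub]

theorem IsLevyProcess.lintegral_exp_nsmul [IsProbabilityMeasure P] (hL : IsLevyProcess P 𝓕 L)
    (u : ℝ) (s : TimeSet T) (n : ℕ) (t : TimeSet T) (h : (t : ℝ≥0) = n * s) :
    ∫⁻ ω, ENNReal.ofReal (Real.exp (u * L t ω)) ∂P =
      (∫⁻ ω, ENNReal.ofReal (Real.exp (u * L s ω)) ∂P) ^ n := by
  induction n generalizing t with
  | zero =>
    have ht : t = TimeSet.zero T := Subtype.ext (by simpa [TimeSet.zero] using h)
    rw [pow_zero, show (1 : ℝ≥0∞) = ∫⁻ _, 1 ∂P by simp]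
    refine lintegral_congr_ae ?_
    filter_upwards [hL.zero] with ω hω
    simp [ht, hω]
  | succ n ih =>
    have ht : (t : ℝ≥0) = n * s + s := by rw [h]; push_cast; ring
    have hle : (n * (s : ℝ≥0)) ≤ t := by simp [ht]
    rw [pow_succ, ← ih ⟨n * s, le_trans (by exact_mod_cast hle) t.2⟩ rfl]
    exact hL.lintegral_exp_add u ht

theorem IsLevyProcess.lintegral_exp_of_rational [IsProbabilityMeasure P]
    (hL : IsLevyProcess P 𝓕 L) (hT : 1 ≤ T) {u κ : ℝ}
    (hκ : ∫⁻ ω, ENNReal.ofReal (Real.exp (u * L (TimeSet.one hT) ω)) ∂P =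
      ENNReal.ofReal (Real.exp κ)) (t : TimeSet T) (k n : ℕ) (h : (t : ℝ≥0) = k / (n + 1)) :
    ∫⁻ ω, ENNReal.ofReal (Real.exp (u * L t ω)) ∂P = ENNReal.ofReal (Real.exp (t * κ)) := by
  have hle : (1 / (n + 1) : ℝ≥0) ≤ 1 := by
    rw [one_div]
    exact inv_le_one_of_one_le₀ (by simp)
  let s : TimeSet T := ⟨1 / (n + 1), le_trans (by exact_mod_cast hle) hT⟩
  have hs1 := hL.lintegral_exp_nsmul u s (n + 1) (TimeSet.one hT) (by
    simp only [TimeSet.one, s]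
    push_cast
    field_simp)
  have hs : ∫⁻ ω, ENNReal.ofReal (Real.exp (u * L s ω)) ∂P =
      ENNReal.ofReal (Real.exp (κ / (n + 1))) := by
    -- The moment at `1 / (n + 1)` is the unique `(n + 1)`-th root of the moment at 1.
    refine (ENNReal.pow_right_strictMono n.succ_ne_zero).injective ?_
    change _ ^ (n + 1) = _ ^ (n + 1)
    rw [← hs1, hκ, ← ENNReal.ofReal_pow (Real.exp_pos _).le, ← Real.exp_nat_mul]
    congr 2
    push_cast
    field_simp
  rw [hL.lintegral_exp_nsmul u s k t (by rw [h]; simp only [s]; ring), hs,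
    ← ENNReal.ofReal_pow (Real.exp_pos _).le, ← Real.exp_nat_mul, h]
  congr 2
  push_cast
  ring

theorem IsLevyProcess.lintegral_exp_le [IsProbabilityMeasure P]
    (hL : IsLevyProcess P 𝓕 L) (hT : 1 ≤ T) {u κ : ℝ}
    (hκ : ∫⁻ ω, ENNReal.ofReal (Real.exp (u * L (TimeSet.one hT) ω)) ∂P =
      ENNReal.ofReal (Real.exp κ)) (t : TimeSet T) :
    ∫⁻ ω, ENNReal.ofReal (Real.exp (u * L t ω)) ∂P ≤ ENNReal.ofReal (Real.exp (t * κ)) := by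
  have hle (n : ℕ) : ((⌊((t : ℝ≥0) : ℝ) * ((n : ℝ) + 1)⌋₊ : ℝ≥0) / (n + 1)) ≤ t := by
    rw [← NNReal.coe_le_coe]
    push_cast
    rw [div_le_iff₀ (by positivity)]
    exact Nat.floor_le (by positivity)
  -- Rounding down keeps the rational approximations inside the time set.
  let r : ℕ → TimeSet T := fun n =>
    ⟨(⌊((t : ℝ≥0) : ℝ) * ((n : ℝ) + 1)⌋₊ : ℝ≥0) / (n + 1),
      le_trans (by exact_mod_cast hle n) t.2⟩
  have hr : Tendsto (fun n => ((r n : ℝ≥0) : ℝ)) atTop (𝓝 ((t : ℝ≥0) : ℝ)) := by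
    have h1 := (tendsto_nat_floor_mul_div_atTop (R := ℝ) (a := ((t : ℝ≥0) : ℝ))
      (NNReal.coe_nonneg _)).comp
        (tendsto_atTop_add_const_right atTop (1 : ℝ) tendsto_natCast_atTop_atTop)
    refine h1.congr fun n => ?_
    simp [r]
  have hr' : Tendsto r atTop (𝓝 t) :=
    tendsto_subtype_rng.2 (NNReal.tendsto_coe.1 hr)
  -- Convergence in probability yields almost sure convergence along a subsequence, as Fatou's lemma
  -- requires.
  obtain ⟨ns, hns, hae⟩ := TendstoInMeasure.exists_seq_tendsto_ae
    (f := fun n => L (r n)) (fun ε hε => (hL.stochastically_continuous t ε hε).comp hr')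
  have hm : Continuous fun x : ℝ => ENNReal.ofReal (Real.exp (u * x)) :=
    ENNReal.continuous_ofReal.comp (by fun_prop)
  have hlim : Tendsto (fun n => ∫⁻ ω, ENNReal.ofReal (Real.exp (u * L (r (ns n)) ω)) ∂P) atTop
      (𝓝 (ENNReal.ofReal (Real.exp (t * κ)))) := by
    simp_rw [fun n => hL.lintegral_exp_of_rational hT hκ (r n) _ n rfl]
    refine ENNReal.tendsto_ofReal ((Real.continuous_exp.tendsto _).comp ?_)
    exact (hr.comp hns.tendsto_atTop).mul_const κ
  calc ∫⁻ ω, ENNReal.ofReal (Real.exp (u * L t ω)) ∂P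
      = ∫⁻ ω, liminf (fun n => ENNReal.ofReal (Real.exp (u * L (r (ns n)) ω))) atTop ∂P := by
        refine lintegral_congr_ae ?_
        filter_upwards [hae] with ω hω
        exact (((hm.tendsto _).comp hω).liminf_eq).symm
    _ ≤ liminf (fun n => ∫⁻ ω, ENNReal.ofReal (Real.exp (u * L (r (ns n)) ω)) ∂P) atTop :=
        lintegral_liminf_le fun n => hm.measurable.comp (hL.measurable _)
    _ = ENNReal.ofReal (Real.exp (t * κ)) := hlim.liminf_eq

/-- The exponential moments of a Lévy process are exponential in time. -/
theorem IsLevyProcess.lintegral_exp_eq [IsProbabilityMeasure P]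
    (hL : IsLevyProcess P 𝓕 L) (hT : 1 ≤ T) {u κ : ℝ}
    (hκ : ∫⁻ ω, ENNReal.ofReal (Real.exp (u * L (TimeSet.one hT) ω)) ∂P =
      ENNReal.ofReal (Real.exp κ)) (t : TimeSet T) :
    ∫⁻ ω, ENNReal.ofReal (Real.exp (u * L t ω)) ∂P = ENNReal.ofReal (Real.exp (t * κ)) := by
  obtain ⟨n, hn⟩ := exists_nat_ge (t : ℝ≥0)
  have hn0 : (0 : ℝ≥0) < n + 1 := by positivity
  have hdiv : (t : ℝ≥0) / (n + 1) ≤ 1 :=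
    (div_le_one hn0).2 (hn.trans (by simp))
  -- Scaling `t` below 1 makes room for the complementary time `s' = 1 - s`; the equality at `s` is
  -- later raised to the power `n + 1`.
  let s : TimeSet T := ⟨t / (n + 1), le_trans (by exact_mod_cast hdiv) hT⟩
  let s' : TimeSet T := ⟨1 - t / (n + 1), le_trans (by exact_mod_cast tsub_le_self) hT⟩
  have hsum : ((TimeSet.one hT : TimeSet T) : ℝ≥0) = s + s' :=
    (add_tsub_cancel_of_le hdiv).symm
  have hmul := hL.lintegral_exp_add u hsum
  have hs : ∫⁻ ω, ENNReal.ofReal (Real.exp (u * L s ω)) ∂P = ENNReal.ofReal (Real.exp (s * κ)) := by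
    refine le_antisymm (hL.lintegral_exp_le hT hκ s) ?_
    have h1 : ENNReal.ofReal (Real.exp (s * κ)) * ENNReal.ofReal (Real.exp (s' * κ)) =
        ENNReal.ofReal (Real.exp κ) := by
      rw [← ENNReal.ofReal_mul (Real.exp_pos _).le, ← Real.exp_add, ← add_mul, ← NNReal.coe_add,
        ← hsum]
      simp [TimeSet.one]
    have h2 : ENNReal.ofReal (Real.exp (s * κ)) * ENNReal.ofReal (Real.exp (s' * κ)) ≤
        (∫⁻ ω, ENNReal.ofReal (Real.exp (u * L s ω)) ∂P) * ENNReal.ofReal (Real.exp (s' * κ)) := by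
      rw [h1, ← hκ, hmul]
      gcongr
      exact hL.lintegral_exp_le hT hκ s'
    -- The factor at `s'` cancels because it is neither 0 nor infinite.
    exact (ENNReal.mul_le_mul_iff_left (by simp [Real.exp_pos]) ENNReal.ofReal_ne_top).1 h2
  rw [hL.lintegral_exp_nsmul u s (n + 1) t (by simp only [s]; push_cast; field_simp), hs,
    ← ENNReal.ofReal_pow (Real.exp_pos _).le, ← Real.exp_nat_mul]
  congr 2
  simp only [s]
  push_cast
  field_simp

theorem integrable_exp_of_lintegral_eq {X : Ω → ℝ} (hX : Measurable X) {u a : ℝ}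
    (h : ∫⁻ ω, ENNReal.ofReal (Real.exp (u * X ω)) ∂P = ENNReal.ofReal a) :
    Integrable (fun ω => Real.exp (u * X ω)) P := by
  refine ⟨by fun_prop, ?_⟩
  rw [hasFiniteIntegral_iff_ofReal (Eventually.of_forall fun ω => (Real.exp_pos _).le), h]
  exact ENNReal.ofReal_lt_top

theorem integral_exp_of_lintegral_eq {X : Ω → ℝ} (hX : Measurable X) {u a : ℝ} (ha : 0 ≤ a)
    (h : ∫⁻ ω, ENNReal.ofReal (Real.exp (u * X ω)) ∂P = ENNReal.ofReal a) :
    ∫ ω, Real.exp (u * X ω) ∂P = a := by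
  rw [integral_eq_lintegral_of_nonneg_ae (Eventually.of_forall fun ω => (Real.exp_pos _).le)
    (by fun_prop), h, ENNReal.toReal_ofReal ha]

theorem IsLevyProcess.martingale_exp [IsProbabilityMeasure P]
    (hL : IsLevyProcess P 𝓕 L) (hT : 1 ≤ T) {u κ : ℝ}
    (hκ : ∫⁻ ω, ENNReal.ofReal (Real.exp (u * L (TimeSet.one hT) ω)) ∂P =
      ENNReal.ofReal (Real.exp κ)) :
    Martingale (fun (t : TimeSet T) ω => Real.exp (u * L t ω) / Real.exp ((t : ℝ) * κ)) 𝓕 P := by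
  have hmeas (t : TimeSet T) :
      StronglyMeasurable[𝓕 t] fun ω => Real.exp (u * L t ω) / Real.exp ((t : ℝ) * κ) := by
    have hm : Measurable fun x : ℝ => Real.exp (u * x) / Real.exp ((t : ℝ) * κ) := by fun_prop
    exact (hm.comp (hL.adapted t)).stronglyMeasurable
  have hint (t : TimeSet T) :
      Integrable (fun ω => Real.exp (u * L t ω) / Real.exp ((t : ℝ) * κ)) P :=
    (integrable_exp_of_lintegral_eq (hL.measurable t) (hL.lintegral_exp_eq hT hκ t)).div_const _
  refine ⟨hmeas, fun s t hst => ?_⟩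
  rcases hst.eq_or_lt with rfl | hlt
  · rw [condExp_of_stronglyMeasurable (𝓕.le s) (hmeas s) (hint s)]
  let r : TimeSet T := ⟨t - s, le_trans (by exact_mod_cast tsub_le_self) t.2⟩
  have hr : (t : ℝ≥0) = s + r := (add_tsub_cancel_of_le (show (s : ℝ≥0) ≤ t from hst)).symm
  have hr' : (t : ℝ) = s + r := by exact_mod_cast congrArg NNReal.toReal hr
  have hinc := (hL.lintegral_exp_increment u hr).trans (hL.lintegral_exp_eq hT hκ r)
  have hmd : Measurable fun ω => L t ω - L s ω := (hL.measurable t).sub (hL.measurable s)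
  -- The ratio `M_t / M_s`: it depends only on the increment, so its conditional expectation is its
  -- mean, 1.
  let g : Ω → ℝ := fun ω => Real.exp (u * (L t ω - L s ω)) / Real.exp ((r : ℝ) * κ)
  have hg : Integrable g P := (integrable_exp_of_lintegral_eq hmd hinc).div_const _
  have hgm : StronglyMeasurable[MeasurableSpace.comap (fun ω => L t ω - L s ω) inferInstance] g := by
    have hm : Measurable fun x : ℝ => Real.exp (u * x) / Real.exp ((r : ℝ) * κ) := by fun_prop
    exact (hm.comp (comap_measurable _)).stronglyMeasurable
  have hg1 : ∫ ω, g ω ∂P = 1 := by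
    rw [integral_div, integral_exp_of_lintegral_eq hmd (Real.exp_pos _).le hinc,
      div_self (Real.exp_pos _).ne']
  have hfg : (fun ω => Real.exp (u * L t ω) / Real.exp ((t : ℝ) * κ)) =
      (fun ω => Real.exp (u * L s ω) / Real.exp ((s : ℝ) * κ)) * g := by
    funext ω
    rw [Pi.mul_apply, div_mul_div_comm, ← Real.exp_add, ← Real.exp_add, hr', add_mul]
    congr 2
    ring
  have hce := condExp_indep_eq hmd.comap_le (𝓕.le s) hgm (hL.indep_increments s t hlt)
  have hpull := condExp_mul_of_stronglyMeasurable_left (hmeas s) (hfg ▸ hint t) hg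
  beta_reduce
  rw [hfg]
  filter_upwards [hpull, hce] with ω h1 h2
  rw [h1, Pi.mul_apply, h2, hg1, mul_one]

end LevyProcess

theorem HasLevyTriplet.integrable_exp {Ω : Type*} {mΩ : MeasurableSpace Ω} {P : Measure Ω}
    [IsProbabilityMeasure P] {T : ℝ≥0∞} {hT : 1 ≤ T} {L : TimeSet T → Ω → ℝ} {b : ℝ} {c : ℝ≥0}
    {ν : Measure ℝ} (hν : HasLevyTriplet hT P L b c ν) (hL : Measurable (L (TimeSet.one hT)))
    {u : ℝ} (hu : ∫⁻ x in {x : ℝ | 1 ≤ |x|}, ENNReal.ofReal (Real.exp (u * x)) ∂ν < ∞) :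
    Integrable (fun ω => Real.exp (u * L (TimeSet.one hT) ω)) P := by
  have hprob : IsProbabilityMeasure (P.map (L (TimeSet.one hT))) :=
    Measure.isProbabilityMeasure_map hL.aemeasurable
  have hu' : IntegrableOn (fun x => Real.exp (u * x)) {x : ℝ | 1 ≤ |x|} ν := by
    refine ⟨by fun_prop, ?_⟩
    rwa [hasFiniteIntegral_iff_ofReal (Eventually.of_forall fun x => (Real.exp_pos _).le)]
  have h := integrable_exp_of_levyKhintchine hν.isLevyMeasure b c (P.map (L (TimeSet.one hT)))
    (fun v => by
      rw [← hν.charFun_eq v, charFun_apply_real, integral_map hL.aemeasurable (by fun_prop)]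
      refine integral_congr_ae (Eventually.of_forall fun ω => ?_)
      simp only
      ring_nf) hu'
  rwa [integrable_map_measure (by fun_prop) hL.aemeasurable] at h

theorem proposition10p2 {Ω : Type*} {mΩ : MeasurableSpace Ω} (P : Measure Ω)
    [IsProbabilityMeasure P] (T : ℝ≥0∞) (hT : 1 ≤ T) (𝓕 : Filtration (TimeSet T) mΩ)
    (L : TimeSet T → Ω → ℝ) (hL : IsLevyProcess P 𝓕 L)
    (b : ℝ) (c : ℝ≥0) (ν : Measure ℝ) (hν : HasLevyTriplet hT P L b c ν)
    (u : ℝ) (hu : ∫⁻ x in {x : ℝ | 1 ≤ |x|}, ENNReal.ofReal (Real.exp (u * x)) ∂ν < ∞) :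
    Integrable (fun ω => Real.exp (u * L (TimeSet.one hT) ω)) P ∧
      Martingale (fun (t : TimeSet T) ω =>
        Real.exp (u * L t ω) / Real.exp ((t : ℝ) * cgf (L (TimeSet.one hT)) P u)) 𝓕 P := by
  have hint := hν.integrable_exp (hL.measurable _) hu
  refine ⟨hint, hL.martingale_exp hT ?_⟩
  -- Integrability is what makes `exp (cgf)` equal to the moment itself.
  rw [exp_cgf hint, mgf, ofReal_integral_eq_lintegral_ofReal hint
    (Eventually.of_forall fun ω => (Real.exp_pos _).le)]
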